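/- Let $k_0$ be a field of characteristic zero and let $V$ be a quasi-projective variety over $k_0$. Write $T_V$ for the theory whose models are the fields $k$ extending $k_0$ with $V(k)=\varnothing$. A model $k$ of $T_V$ is called existentially closed if, for every quasi-projective variety $X$ over $k$ such that $X(l)\neq\varnothing$ for some extension field $l$ of $k$ that is a model of $T_V$ (where $X(l)$ is the set of morphisms $\operatorname{Spec} l\to X$ over $\operatorname{Spec} k$), one has $X(k)\neq\varnothing$. Let $k$ be a model of $T_V$. Then $k$ is existentially closed if and only if both of the following conditions hold: - $(\mathrm{I}_V)$ for every proper finite field extension $l/k$, $V(l)\neq\varnothing$; - $(\mathrm{II}_V)$ for every geometrically integral variety $X$ over $k$, either there is a non-constant rational map $X\dashrightarrow V_k$ over $k$, or the set $X(k)$ of $k$-rational points is Zariski dense in $X$. Here a variety over a field $k$ is a separated scheme of finite type over $k$; it is quasi-projective if it is isomorphic over $k$ to a locally closed subscheme of a projective space $\mathbb{P}^n_k$; $V_k$ is the base change of $V$ to $k$; and a rational map $X\dashrightarrow V_k$ over $k$ is constant if it factors through $\operatorname{Spec} k$ (over $k$). -/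

import Mathlib

open AlgebraicGeometry CategoryTheory CategoryTheory.Limits

universe u

namespace AvoidingFields

noncomputable section

attribute [local instance] MvPolynomial.gradedAlgebra

/-- The `K`-valued points of `X` over `R`: morphisms `Spec K ⟶ X` over `Spec R`,
for `X` a scheme over `R` with structure morphism `s` and `K` an `R`-algebra. -/
def Points {R : Type u} [CommRing R] {X : Scheme.{u}} (s : X ⟶ Spec (.of R))
    (K : Type u) [CommRing K] [Algebra R K] : Set (Spec (.of K) ⟶ X) :=
  {p | p ≫ s = Spec.map (CommRingCat.ofHom (algebraMap R K))}

/-- Projective `n`-space over `k`, i.e. `Proj k[x₀, …, xₙ]`. -/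
def ProjSpace (k : Type u) [CommRing k] (n : ℕ) : Scheme.{u} :=
  Proj (MvPolynomial.homogeneousSubmodule (Fin (n + 1)) k)

/-- The structure morphism of projective `n`-space over `k`. -/
def ProjSpace.toSpec (k : Type u) [CommRing k] (n : ℕ) :
    ProjSpace k n ⟶ Spec (.of k) :=
  Proj.toSpecZero (MvPolynomial.homogeneousSubmodule (Fin (n + 1)) k) ≫
    Spec.map (CommRingCat.ofHom
      (algebraMap k (MvPolynomial.homogeneousSubmodule (Fin (n + 1)) k 0)))

/-- A variety over `k`: a separated scheme of finite type over `k`. -/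
structure IsVariety {k : Type u} [Field k] {X : Scheme.{u}} (s : X ⟶ Spec (.of k)) : Prop where
  isSeparated : IsSeparated s
  locallyOfFiniteType : LocallyOfFiniteType s
  quasiCompact : QuasiCompact s

/-- A quasi-projective variety over `k`: a scheme over `k` that is isomorphic over `k` to a
locally closed subscheme of some projective space over `k`. -/
def IsQuasiProjective {k : Type u} [Field k] {X : Scheme.{u}} (s : X ⟶ Spec (.of k)) : Prop :=
  ∃ (n : ℕ) (i : X ⟶ ProjSpace k n), IsImmersion i ∧ i ≫ ProjSpace.toSpec k n = s

/-- The `k`-points of `X` are Zariski dense in `X`. -/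
def HasDensePoints {k : Type u} [Field k] {X : Scheme.{u}} (s : X ⟶ Spec (.of k)) : Prop :=
  Dense {x : X | ∃ p ∈ Points s k, x ∈ Set.range p}

/-- The rational map `f` between schemes over `k` is a rational map over `k`. -/
def IsOverBase {k : Type u} [Field k] {X Y : Scheme.{u}}
    (sX : X ⟶ Spec (.of k)) (sY : Y ⟶ Spec (.of k)) (f : X ⤏ Y) : Prop :=
  f.compHom sY = sX.toRationalMap

/-- The rational map `f` over `k` is constant: it factors through `Spec k`, over `k`. -/
def IsConstant {k : Type u} [Field k] {X Y : Scheme.{u}}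
    (sX : X ⟶ Spec (.of k)) (sY : Y ⟶ Spec (.of k)) (f : X ⤏ Y) : Prop :=
  ∃ y ∈ Points sY k, f = Scheme.Hom.toRationalMap (sX ≫ y)

variable {k₀ : Type u} [Field k₀] {V : Scheme.{u}} (π : V ⟶ Spec (.of k₀))
  (k : Type u) [Field k] [Algebra k₀ k]

/-- The extension field `k` of `k₀` is a model of `T_V`: it has no points in `V`. -/
def IsModel : Prop := Points π k = ∅

/-- The base change `V_k` of `V` to the extension field `k` of `k₀`. -/
abbrev BaseChange : Scheme.{u} :=
  pullback π (Spec.map (CommRingCat.ofHom (algebraMap k₀ k)))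

/-- The structure morphism `V_k ⟶ Spec k`. -/
abbrev BaseChange.toSpec : BaseChange π k ⟶ Spec (.of k) :=
  pullback.snd π (Spec.map (CommRingCat.ofHom (algebraMap k₀ k)))

/-- `k` is an existentially closed model of `T_V`. -/
def IsExistentiallyClosed : Prop :=
  IsModel π k ∧
    ∀ (X : Scheme.{u}) (s : X ⟶ Spec (.of k)), IsQuasiProjective s →
      (∃ (l : Type u) (_ : Field l) (_ : Algebra k₀ l) (_ : Algebra k l)
        (_ : IsScalarTower k₀ k l), IsModel π l ∧ (Points s l).Nonempty) →
      (Points s k).Nonempty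

/-- Condition `(I_V)`: every proper finite extension of `k` has a point of `V`. -/
def ConditionI : Prop :=
  ∀ (l : Type u) [Field l] [Algebra k₀ l] [Algebra k l] [IsScalarTower k₀ k l],
    FiniteDimensional k l → ¬ Function.Surjective (algebraMap k l) → (Points π l).Nonempty

/-- Condition `(II_V)`: every geometrically integral variety `X` over `k` has a non-constant
rational map to `V_k` over `k`, or its `k`-points are Zariski dense. -/
def ConditionII : Prop :=
  ∀ (X : Scheme.{u}) (s : X ⟶ Spec (.of k)), IsVariety s → GeometricallyIntegral s →
    (∃ f : X ⤏ BaseChange π k, IsOverBase s (BaseChange.toSpec π k) f ∧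
      ¬ IsConstant s (BaseChange.toSpec π k) f) ∨
    HasDensePoints s

end

end AvoidingFields

/-! If `k` is existentially closed and `l/k` is proper finite with `V(l)` empty, then `Spec l` has
an `l`-point, hence a `k`-point; this is a retraction `l → k`, which is absurd. If the `k`-points of
`X` are not dense, some nonempty affine open `W` has none, yet its generic point is a point over the
function field `K`; so `K` is not a model, and a point of `V` over `K` is a rational map to `V_k`.
It is non-constant because `V(k)` is empty.

Conversely, let `X` have a point over a model `l`. Condition I makes `k` algebraically closed in
`l`, so in characteristic zero `l/k` is regular (`isDomain_tensorProduct_of_isIntegrallyClosedIn`).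
The closure of the `l`-point in an affine open of `X` is then a geometrically integral `Spec B` with
`B ⊆ l`. A rational map from it to `V_k` would give an `l`-point of `V`, so Condition II leaves
dense `k`-points on `Spec B`, and these map to `X`. -/

/-! ### Regular extensions in characteristic zero. -/

open TensorProduct Polynomial in
theorem minpoly_map_of_isIntegrallyClosedIn {k l Ω : Type*} [Field k] [Field l] [Field Ω]
    [Algebra k l] [Algebra l Ω] [Algebra k Ω] [IsScalarTower k l Ω] [IsIntegrallyClosedIn k l]
    (α : Ω) (hα : IsIntegral k α) :
    (minpoly k α).map (algebraMap k l) = minpoly l α := by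
  have hαl : IsIntegral l α := hα.tower_top
  have hd : minpoly l α ∣ (minpoly k α).map (algebraMap k l) :=
    minpoly.dvd_map_of_isScalarTower k l α
  -- A monic divisor over `l` of a monic polynomial over `k` has coefficients integral over `k`,
  -- hence in `k`.
  have h1 := integralClosure.mem_lifts_of_monic_of_dvd_map l (minpoly.monic hα)
    (minpoly.monic hαl) hd
  have h2 : minpoly l α ∈ Polynomial.lifts (algebraMap k l) := by
    rw [Polynomial.lifts_iff_coeff_lifts] at h1 ⊢
    intro n
    obtain ⟨c, hc⟩ := h1 n
    rw [← hc]
    exact IsIntegrallyClosedIn.isIntegral_iff.mp c.2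
  obtain ⟨q, hq, -, hqm⟩ := Polynomial.lifts_and_natDegree_eq_and_monic h2 (minpoly.monic hαl)
  have hq0 : aeval α q = 0 := by
    rw [← aeval_map_algebraMap l, hq, minpoly.aeval]
  refine (eq_of_monic_of_associated (minpoly.monic hαl) ((minpoly.monic hα).map _)
    (associated_of_dvd_dvd hd ?_)).symm
  rw [← hq]
  exact Polynomial.map_dvd _ (minpoly.dvd k α hq0)

open TensorProduct in
theorem isDomain_tensorProduct_of_finiteDimensional {k l E : Type*} [Field k] [CharZero k] [Field l]
    [Field E] [Algebra k l] [Algebra k E] [IsIntegrallyClosedIn k l] [FiniteDimensional k E] :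
    IsDomain (E ⊗[k] l) := by
  let Ω := AlgebraicClosure l
  let f : E →ₐ[k] Ω := IsAlgClosed.lift
  have hfd : FiniteDimensional k f.fieldRange :=
    (AlgEquiv.ofInjectiveField f).toLinearEquiv.finiteDimensional
  obtain ⟨a, ha⟩ := Field.exists_primitive_element k f.fieldRange
  have hai : IsIntegral k a := IsIntegral.of_finite k a
  let pb := IntermediateField.adjoin.powerBasis hai
  let e : IntermediateField.adjoin k {a} ≃ₐ[k] f.fieldRange :=
    (IntermediateField.equivOfEq ha).trans IntermediateField.topEquiv
  let b := pb.basis.map e.toLinearEquiv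
  have hb : ∀ i, (b i : Ω) = (a : Ω) ^ (i : ℕ) := by
    intro i
    simp [b, e, pb]
  have hdim : pb.dim = (minpoly l (a : Ω)).natDegree := by
    rw [← minpoly_map_of_isIntegrallyClosedIn (k := k) (a : Ω) (hai.map f.fieldRange.val),
      Polynomial.natDegree_map, ← IntermediateField.minpoly_eq]
    simp [pb]
  -- The degree of the primitive element does not drop over `l`, so its powers stay independent.
  have hlin : LinearIndependent l (f.fieldRange.val ∘ b) := by
    have h := (linearIndependent_pow (K := l) (a : Ω)).comp (finCongr hdim)
      (finCongr hdim).injective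
    convert h using 1
    ext i
    simpa using hb i
  have H : f.fieldRange.LinearDisjoint l := .of_basis_left b hlin
  have := H.isDomain
  let e' : E ⊗[k] l ≃ₐ[k] f.fieldRange ⊗[k] l :=
    Algebra.TensorProduct.congr (AlgEquiv.ofInjectiveField f) AlgEquiv.refl
  exact e'.toMulEquiv.isDomain

-- Two elements with zero product already live over one finitely generated `B`, and `C ⊗ B` embeds
-- in `C ⊗ A` by flatness.
open TensorProduct in
theorem isDomain_tensorProduct_of_forall_fg {k A C : Type*} [Field k] [CommRing A] [CommRing C]
    [Algebra k A] [Algebra k C] [Nontrivial A] [Nontrivial C]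
    (h : ∀ B : Subalgebra k A, B.FG → IsDomain (C ⊗[k] B)) : IsDomain (C ⊗[k] A) := by
  have : Nontrivial (C ⊗[k] A) := inferInstance
  have : NoZeroDivisors (C ⊗[k] A) := by
    refine ⟨fun {x y} hxy ↦ ?_⟩
    obtain ⟨D₁, hD₁, hx⟩ := exists_fg_and_mem_baseChange x
    obtain ⟨D₂, hD₂, hy⟩ := exists_fg_and_mem_baseChange y
    have hmono : ∀ {D D' : Subalgebra k A}, D ≤ D' → D.baseChange C ≤ D'.baseChange C := by
      rintro D D' hD _ ⟨z, rfl⟩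
      refine ⟨Algebra.TensorProduct.map (AlgHom.id C C) (Subalgebra.inclusion hD) z, ?_⟩
      induction z with
      | zero => simp
      | add z w hz hw => simp only [map_add] at hz hw ⊢; rw [hz, hw]
      | tmul c d => rfl
    have hx : x ∈ (D₁ ⊔ D₂).baseChange C := hmono le_sup_left hx
    have hy : y ∈ (D₁ ⊔ D₂).baseChange C := hmono le_sup_right hy
    have hD := h (D₁ ⊔ D₂) (hD₁.sup hD₂)
    have h_inj : Function.Injective (Algebra.TensorProduct.map (AlgHom.id C C) (D₁ ⊔ D₂).val) :=
      Module.Flat.lTensor_preserves_injective_linearMap _ Subtype.val_injective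
    obtain ⟨x, rfl⟩ := hx
    obtain ⟨y, rfl⟩ := hy
    have hxy' : x * y = 0 := h_inj (by
      rw [map_zero, map_mul]; exact hxy)
    rcases mul_eq_zero.mp hxy' with rfl | rfl
    · left; exact map_zero (Algebra.TensorProduct.map (AlgHom.id C C) (D₁ ⊔ D₂).val)
    · right; exact map_zero (Algebra.TensorProduct.map (AlgHom.id C C) (D₁ ⊔ D₂).val)
  exact NoZeroDivisors.to_isDomain _

open TensorProduct in
theorem isDomain_tensorProduct_of_isAlgebraic {k l E : Type*} [Field k] [CharZero k] [Field l]
    [Field E] [Algebra k l] [Algebra k E] [IsIntegrallyClosedIn k l] [Algebra.IsAlgebraic k E] :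
    IsDomain (l ⊗[k] E) := by
  refine isDomain_tensorProduct_of_forall_fg fun B hB ↦ ?_
  have : Algebra.FiniteType k B := (Subalgebra.fg_iff_finiteType B).mp hB
  have : Algebra.IsIntegral k B := ⟨fun x ↦ by
    have := Algebra.IsIntegral.isIntegral (R := k) (x : E)
    exact (isIntegral_algHom_iff B.val Subtype.val_injective).mp this⟩
  have : Module.Finite k B := Algebra.IsIntegral.finite
  let E' := B.toIntermediateField' (isField_of_isIntegral_of_isField' (Field.toIsField k))
  have : FiniteDimensional k E' := ‹Module.Finite k B›
  have := isDomain_tensorProduct_of_finiteDimensional (k := k) (l := l) (E := E')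
  exact (Algebra.TensorProduct.comm k l E').toMulEquiv.isDomain

/-- The Nullstellensatz, applied to the localization of `A` away from `c`. -/
theorem exists_algHom_ne_zero_of_isAlgClosed {F A : Type*} [Field F] [IsAlgClosed F] [CommRing A]
    [IsDomain A] [Algebra F A] [Algebra.FiniteType F A] (c : A) (hc : c ≠ 0) :
    ∃ φ : A →ₐ[F] F, φ c ≠ 0 := by
  let B := Localization.Away c
  have : Algebra.FiniteType A B := IsLocalization.finiteType_of_monoid_fg (Submonoid.powers c) B
  have : Algebra.FiniteType F B := .trans (S := A) inferInstance inferInstance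
  have : Nontrivial B := (IsLocalization.injective B
    (powers_le_nonZeroDivisors_of_noZeroDivisors hc)).nontrivial
  obtain ⟨M, hM⟩ := Ideal.exists_maximal B
  let : Field (B ⧸ M) := Ideal.Quotient.field M
  have : Module.Finite F (B ⧸ M) := finite_of_finite_type_of_isJacobsonRing F (B ⧸ M)
  have hb : Function.Bijective (algebraMap F (B ⧸ M)) :=
    IsAlgClosed.algebraMap_bijective_of_isIntegral
  let e : (B ⧸ M) ≃ₐ[F] F := (AlgEquiv.ofBijective (Algebra.ofId F (B ⧸ M)) hb).symm
  let ψ : B →ₐ[F] F := (e : (B ⧸ M) →ₐ[F] F).comp (Ideal.Quotient.mkₐ F M)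
  refine ⟨ψ.comp (IsScalarTower.toAlgHom F A B), ?_⟩
  have hu : IsUnit (algebraMap A B c) := IsLocalization.Away.algebraMap_isUnit c
  exact (hu.map ψ).ne_zero

open TensorProduct in
theorem isDomain_tensorProduct_of_isAlgClosed {F A B : Type*} [Field F] [IsAlgClosed F]
    [CommRing A] [IsDomain A] [CommRing B] [IsDomain B] [Algebra F A] [Algebra F B] :
    IsDomain (B ⊗[F] A) := by
  refine isDomain_tensorProduct_of_forall_fg fun D hD ↦ ?_
  have : Algebra.FiniteType F D := (Subalgebra.fg_iff_finiteType D).mp hD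
  let b := Module.Free.chooseBasis F B
  let bD := b.baseChange D
  suffices IsDomain (D ⊗[F] B) from (Algebra.TensorProduct.comm F B D).toMulEquiv.isDomain
  have : NoZeroDivisors (D ⊗[F] B) := by
    refine ⟨fun {x y} hxy ↦ ?_⟩
    by_contra! hne
    obtain ⟨i, hi⟩ : ∃ i, bD.repr x i ≠ 0 := by
      by_contra! h
      exact hne.1 (bD.repr.map_eq_zero_iff.mp (Finsupp.ext h))
    obtain ⟨j, hj⟩ : ∃ j, bD.repr y j ≠ 0 := by
      by_contra! h
      exact hne.2 (bD.repr.map_eq_zero_iff.mp (Finsupp.ext h))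
    -- Specializing `D` at an `F`-point where both chosen coordinates survive gives two nonzero
    -- elements of the domain `B` with zero product.
    obtain ⟨φ, hφ⟩ := exists_algHom_ne_zero_of_isAlgClosed (F := F) _ (mul_ne_zero hi hj)
    let Φ : D ⊗[F] B →ₐ[F] B :=
      (Algebra.TensorProduct.lid F B : F ⊗[F] B →ₐ[F] B).comp
        (Algebra.TensorProduct.map φ (AlgHom.id F B))
    have hΦ : ∀ z i, b.repr (Φ z) i = φ (bD.repr z i) := by
      intro z i
      induction z with
      | zero => simp
      | add z w hz hw => simp [hz, hw]
      | tmul d c => simp [Φ, bD, mul_comm]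
    rw [map_mul] at hφ
    have h0 : Φ x * Φ y = 0 := by rw [← map_mul, hxy, map_zero]
    rcases mul_eq_zero.mp h0 with h | h
    · exact hφ (by rw [← hΦ x i, h]; simp)
    · exact hφ (by rw [← hΦ y j, h]; simp)
  exact NoZeroDivisors.to_isDomain _

open TensorProduct in
/-- A field extension of characteristic zero in which the base field is algebraically closed
is regular. -/
theorem isDomain_tensorProduct_of_isIntegrallyClosedIn {k l K : Type*} [Field k] [CharZero k]
    [Field l] [Field K] [Algebra k l] [Algebra k K] [IsIntegrallyClosedIn k l] :
    IsDomain (l ⊗[k] K) := by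
  let Ω := AlgebraicClosure K
  let F := AlgebraicClosure k
  let i : F →ₐ[k] Ω := IsAlgClosed.lift
  let : Algebra F Ω := i.toRingHom.toAlgebra
  have : IsScalarTower k F Ω := .of_algebraMap_eq fun x ↦ (i.commutes x).symm
  -- The extension is split as `k ⊆ F ⊆ Ω`: finite levels settle `F/k`, and over the algebraically
  -- closed `F` any two domains have a domain as tensor product.
  have h1 : IsDomain (l ⊗[k] F) := isDomain_tensorProduct_of_isAlgebraic
  have : IsDomain (F ⊗[k] l) := (Algebra.TensorProduct.comm k F l).toMulEquiv.isDomain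
  have h2 : IsDomain (Ω ⊗[F] (F ⊗[k] l)) := isDomain_tensorProduct_of_isAlgClosed
  have h3 : IsDomain (Ω ⊗[k] l) :=
    (Algebra.TensorProduct.cancelBaseChange k F F Ω l).symm.toMulEquiv.isDomain
  have h4 : IsDomain (l ⊗[k] Ω) := (Algebra.TensorProduct.comm k l Ω).toMulEquiv.isDomain
  have h_inj : Function.Injective
      (Algebra.TensorProduct.map (AlgHom.id k l) (IsScalarTower.toAlgHom k K Ω)) :=
    Module.Flat.lTensor_preserves_injective_linearMap _ (algebraMap K Ω).injective
  exact h_inj.isDomain (Algebra.TensorProduct.map (AlgHom.id k l)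
    (IsScalarTower.toAlgHom k K Ω)).toRingHom

/-! ### Affine schemes of finite type are quasi-projective. -/

namespace AvoidingFields
section

attribute [local instance] MvPolynomial.gradedAlgebra

theorem IsQuasiProjective.comp_immersion {k : Type u} [Field k] {X Y : Scheme.{u}}
    {s : X ⟶ Spec (.of k)} (hs : IsQuasiProjective s) (j : Y ⟶ X) [IsImmersion j] :
    IsQuasiProjective (j ≫ s) := by
  obtain ⟨n, i, hi, rfl⟩ := hs
  exact ⟨n, j ≫ i, inferInstance, Category.assoc ..⟩

open HomogeneousLocalization in
theorem isQuasiProjective_Spec (k A : Type u) [Field k] [CommRing A] [Algebra k A]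
    [Algebra.FiniteType k A] :
    IsQuasiProjective (Spec.map (CommRingCat.ofHom (algebraMap k A))) := by
  obtain ⟨n, φ, hφ⟩ := Algebra.FiniteType.iff_quotient_mvPolynomial''.mp
    (inferInstance : Algebra.FiniteType k A)
  let 𝒜 := MvPolynomial.homogeneousSubmodule (Fin (n + 1)) k
  have hX (i : Fin (n + 1)) : (MvPolynomial.X i : MvPolynomial (Fin (n + 1)) k) ∈ 𝒜 1 :=
    MvPolynomial.isHomogeneous_X k i
  -- Dehomogenization at `X 0 = 1`; it will identify `Spec A` with a closed subscheme of the chart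
  -- where `X 0` is invertible.
  let ψ : MvPolynomial (Fin (n + 1)) k →ₐ[k] A :=
    MvPolynomial.aeval (Fin.cons 1 fun i ↦ φ (MvPolynomial.X i))
  have hψ0 : ψ (MvPolynomial.X 0) = 1 := by simp [ψ]
  have hψs (i : Fin n) : ψ (MvPolynomial.X i.succ) = φ (MvPolynomial.X i) := by simp [ψ]
  let L : Localization.Away (MvPolynomial.X 0 : MvPolynomial (Fin (n + 1)) k) →+* A :=
    IsLocalization.Away.lift (MvPolynomial.X 0) (g := ψ.toRingHom) (by
      change IsUnit (ψ (MvPolynomial.X 0)); rw [hψ0]; exact isUnit_one)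
  have hL (p) : L (algebraMap _ _ p) = ψ p := IsLocalization.Away.lift_eq _ _ _
  let θ : Away 𝒜 (MvPolynomial.X 0) →+* A := L.comp (algebraMap _ _)
  have hθ_mk (m : ℕ) (p) (hp : p ∈ 𝒜 (m • 1)) : θ (Away.mk 𝒜 (hX 0) m p hp) = ψ p := by
    have h1 : L (Localization.mk p ⟨MvPolynomial.X 0 ^ m, m, rfl⟩) * ψ (MvPolynomial.X 0 ^ m) =
        ψ p := by
      rw [← hL, ← hL, ← map_mul, Localization.mk_eq_mk']
      exact congrArg L (IsLocalization.mk'_spec _ p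
        (⟨MvPolynomial.X 0 ^ m, m, rfl⟩ : Submonoid.powers _))
    rw [map_pow, hψ0, one_pow, mul_one] at h1
    rw [← h1]
    simp only [θ, RingHom.comp_apply, HomogeneousLocalization.algebraMap_apply, Away.val_mk]
  have hθ0 (a : k) : θ (fromZeroRingHom 𝒜 _ (algebraMap k (𝒜 0) a)) = algebraMap k A a := by
    rw [← ψ.commutes a]
    refine Eq.trans (congrArg θ ?_) (hθ_mk 0 (algebraMap k _ a)
      (by simpa using (algebraMap k (𝒜 0) a).2))
    apply val_injective
    rw [Away.val_mk]
    simp only [pow_zero]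
    rfl
  have hθX (i : Fin n) : ∃ z, θ z = φ (MvPolynomial.X i) :=
    ⟨_, (hθ_mk 1 (MvPolynomial.X i.succ) (by simpa using hX _)).trans (hψs i)⟩
  have hθ : Function.Surjective θ := by
    intro a
    obtain ⟨p, rfl⟩ := hφ a
    induction p using MvPolynomial.induction_on with
    | C a => exact ⟨_, (hθ0 a).trans (φ.commutes a).symm⟩
    | add p q hp hq =>
      obtain ⟨x, hx⟩ := hp
      obtain ⟨y, hy⟩ := hq
      exact ⟨x + y, by rw [map_add, map_add, hx, hy]⟩
    | mul_X p i hp =>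
      obtain ⟨x, hx⟩ := hp
      obtain ⟨z, hz⟩ := hθX i
      exact ⟨x * z, by rw [map_mul, map_mul, hx, hz]⟩
  have : IsClosedImmersion (Spec.map (CommRingCat.ofHom θ)) :=
    IsClosedImmersion.spec_of_surjective _ hθ
  have hcomp : CommRingCat.ofHom (algebraMap k (𝒜 0)) ≫
      CommRingCat.ofHom (fromZeroRingHom 𝒜 (.powers (MvPolynomial.X 0))) ≫ CommRingCat.ofHom θ =
      CommRingCat.ofHom (algebraMap k A) := by
    ext a; exact hθ0 a
  let i : Spec (.of A) ⟶ Proj 𝒜 :=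
    Spec.map (CommRingCat.ofHom θ) ≫ Proj.awayι 𝒜 _ (hX 0) one_pos
  have hi : i ≫ Proj.toSpecZero 𝒜 ≫ Spec.map (CommRingCat.ofHom (algebraMap k (𝒜 0))) =
      Spec.map (CommRingCat.ofHom (algebraMap k A)) := by
    rw [Category.assoc, Proj.awayι_toSpecZero_assoc, ← Spec.map_comp, ← Spec.map_comp,
      Category.assoc, hcomp]
  have : IsImmersion i := inferInstance
  exact ⟨n, i, this, hi⟩

theorem isQuasiProjective_of_isAffine {k : Type u} [Field k] {X : Scheme.{u}} [IsAffine X]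
    (s : X ⟶ Spec (.of k)) [LocallyOfFiniteType s] : IsQuasiProjective s := by
  obtain ⟨f, hf⟩ := Spec.map_surjective (X.isoSpec.inv ≫ s)
  algebraize [f.hom]
  have h1 : LocallyOfFiniteType (Spec.map f) := hf ▸ inferInstance
  have : Algebra.FiniteType k Γ(X, ⊤) := HasRingHomProperty.Spec_iff.mp h1
  have h2 := (isQuasiProjective_Spec k Γ(X, ⊤)).comp_immersion X.isoSpec.hom
  have h3 : CommRingCat.ofHom (algebraMap k Γ(X, ⊤)) = f := rfl
  rwa [h3, hf, Iso.hom_inv_id_assoc] at h2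

/-- Needed to pass between points over a function field and rational maps. -/
theorem IsQuasiProjective.locallyOfFiniteType {k : Type u} [Field k] {X : Scheme.{u}}
    {s : X ⟶ Spec (.of k)} (hs : IsQuasiProjective s) : LocallyOfFiniteType s := by
  obtain ⟨n, i, hi, rfl⟩ := hs
  let 𝒜 := MvPolynomial.homogeneousSubmodule (Fin (n + 1)) k
  have hsurj : Function.Surjective (algebraMap k (𝒜 0)) := by
    rintro ⟨p, hp⟩
    rw [MvPolynomial.mem_homogeneousSubmodule, ← MvPolynomial.totalDegree_zero_iff_isHomogeneous,
      MvPolynomial.totalDegree_eq_zero_iff_eq_C] at hp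
    exact ⟨_, Subtype.ext hp.symm⟩
  have : IsScalarTower k (𝒜 0) (MvPolynomial (Fin (n + 1)) k) :=
    ⟨fun a x y ↦ smul_mul_assoc a (x : MvPolynomial (Fin (n + 1)) k) y⟩
  have : Algebra.FiniteType (𝒜 0) (MvPolynomial (Fin (n + 1)) k) :=
    .of_restrictScalars_finiteType k _ _
  have h1 : LocallyOfFiniteType (Spec.map (CommRingCat.ofHom (algebraMap k (𝒜 0)))) :=
    have := IsClosedImmersion.spec_of_surjective (CommRingCat.ofHom (algebraMap k (𝒜 0))) hsurj
    inferInstance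
  have h2 : LocallyOfFiniteType (Proj.toSpecZero 𝒜) := inferInstance
  have h3 : LocallyOfFiniteType (ProjSpace.toSpec k n) :=
    MorphismProperty.comp_mem @LocallyOfFiniteType _ _ h2 h1
  infer_instance

end
end AvoidingFields

/-! ### Functoriality of points and models. -/

namespace AvoidingFields

theorem Points.comp_algHom {R : Type u} [CommRing R] {X : Scheme.{u}} {s : X ⟶ Spec (.of R)}
    {K L : Type u} [CommRing K] [CommRing L] [Algebra R K] [Algebra R L] (φ : K →ₐ[R] L)
    {p : Spec (.of K) ⟶ X} (hp : p ∈ Points s K) :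
    Spec.map (CommRingCat.ofHom φ.toRingHom) ≫ p ∈ Points s L := by
  change _ = _ at hp
  change _ = _
  rw [Category.assoc, hp, ← Spec.map_comp, ← CommRingCat.ofHom_comp]
  congr 2
  exact φ.comp_algebraMap

theorem Points.comp_hom {R : Type u} [CommRing R] {X Y : Scheme.{u}} {s : X ⟶ Spec (.of R)}
    {K : Type u} [CommRing K] [Algebra R K] {p : Spec (.of K) ⟶ Y} (j : Y ⟶ X)
    (hp : p ∈ Points (j ≫ s) K) : p ≫ j ∈ Points s K :=
  (Category.assoc ..).trans hp

theorem IsModel.of_algHom {k₀ : Type u} [Field k₀] {V : Scheme.{u}} {π : V ⟶ Spec (.of k₀)}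
    {K L : Type u} [Field K] [Field L] [Algebra k₀ K] [Algebra k₀ L] (φ : K →ₐ[k₀] L)
    (hL : IsModel π L) : IsModel π K := by
  refine Set.eq_empty_iff_forall_notMem.mpr fun p hp ↦ ?_
  exact Set.eq_empty_iff_forall_notMem.mp hL _ (Points.comp_algHom φ hp)

theorem points_baseChange_nonempty_iff {k₀ : Type u} [Field k₀] {V : Scheme.{u}}
    (π : V ⟶ Spec (.of k₀)) (k K : Type u) [Field k] [Algebra k₀ k] [Field K] [Algebra k₀ K]
    [Algebra k K] [IsScalarTower k₀ k K] :
    (Points (BaseChange.toSpec π k) K).Nonempty ↔ (Points π K).Nonempty := by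
  have h : Spec.map (CommRingCat.ofHom (algebraMap k K)) ≫
      Spec.map (CommRingCat.ofHom (algebraMap k₀ k)) =
      Spec.map (CommRingCat.ofHom (algebraMap k₀ K)) := by
    rw [← Spec.map_comp, ← CommRingCat.ofHom_comp, ← IsScalarTower.algebraMap_eq]
  constructor
  · rintro ⟨p, hp⟩
    change _ = _ at hp
    refine ⟨p ≫ pullback.fst _ _, ?_⟩
    change _ = _
    rw [Category.assoc, pullback.condition, ← Category.assoc, hp, h]
  · rintro ⟨p, hp⟩
    change _ = _ at hp
    exact ⟨pullback.lift p (Spec.map (CommRingCat.ofHom (algebraMap k K))) (by rw [hp, h]),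
      pullback.lift_snd _ _ _⟩

/-! ### Existentially closed models satisfy both conditions. -/

theorem IsExistentiallyClosed.conditionI {k₀ : Type u} [Field k₀] {V : Scheme.{u}}
    {π : V ⟶ Spec (.of k₀)} {k : Type u} [Field k] [Algebra k₀ k]
    (h : IsExistentiallyClosed π k) : ConditionI π k := by
  intro l _ _ _ _ _ hl
  by_contra hne
  have hmodel : IsModel π l := Set.not_nonempty_iff_eq_empty.mp hne
  have hid : 𝟙 (Spec (.of l)) ∈ Points (Spec.map (CommRingCat.ofHom (algebraMap k l))) l :=
    Category.id_comp _
  obtain ⟨p, hp⟩ := h.2 _ _ (isQuasiProjective_Spec k l) ⟨l, _, _, _, ‹_›, hmodel, _, hid⟩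
  obtain ⟨f, rfl⟩ := Spec.map_surjective p
  change _ = _ at hp
  rw [← Spec.map_comp] at hp
  -- `f` is a retraction of `k → l`; being injective, it forces `k → l` to be onto.
  have hf : ∀ a, f.hom (algebraMap k l a) = a := fun a ↦
    congr($(Spec.map_injective hp) a)
  exact hl fun b ↦ ⟨f.hom b, f.hom.injective (hf _)⟩

theorem IsConstant.points_nonempty {k : Type u} [Field k] {X Y : Scheme.{u}}
    {sX : X ⟶ Spec (.of k)} {sY : Y ⟶ Spec (.of k)} {f : X ⤏ Y} (h : IsConstant sX sY f) :
    (Points sY k).Nonempty :=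
  h.imp fun _ hy ↦ hy.1

theorem exists_isAffineOpen_forall_points_notMem {k : Type u} [Field k] {X : Scheme.{u}}
    {s : X ⟶ Spec (.of k)} (h : ¬ HasDensePoints s) :
    ∃ W : X.Opens, IsAffineOpen W ∧ (W : Set X).Nonempty ∧ Points (W.ι ≫ s) k = ∅ := by
  rw [HasDensePoints, dense_iff_inter_open] at h
  push Not at h
  obtain ⟨U, hU, ⟨x, hx⟩, hdisj⟩ := h
  obtain ⟨W, hW, hxW, hWU⟩ := exists_isAffineOpen_mem_and_subset (U := ⟨U, hU⟩) hx
  refine ⟨W, hW, ⟨x, hxW⟩, Set.eq_empty_iff_forall_notMem.mpr fun p hp ↦ ?_⟩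
  let y : Spec (.of k) := IsLocalRing.closedPoint k
  exact Set.eq_empty_iff_forall_notMem.mp hdisj ((p ≫ W.ι) y)
    ⟨hWU (p y).2, _, Points.comp_hom _ hp, y, rfl⟩

theorem IsExistentiallyClosed.conditionII {k₀ : Type u} [Field k₀] {V : Scheme.{u}}
    {π : V ⟶ Spec (.of k₀)} (hV : IsQuasiProjective π) {k : Type u} [Field k] [Algebra k₀ k]
    (h : IsExistentiallyClosed π k) : ConditionII π k := by
  intro X s hs _
  by_cases hd : HasDensePoints s
  · exact Or.inr hd
  left
  have := hs.locallyOfFiniteType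
  have := hV.locallyOfFiniteType
  have : Subsingleton (Spec (.of k)) := inferInstanceAs (Subsingleton (PrimeSpectrum k))
  have : IsIntegral X := GeometricallyIntegral.isIntegral_of_subsingleton s
  obtain ⟨φ, hφ⟩ := Spec.map_surjective (X.fromSpecStalk (genericPoint X) ≫ s)
  let K : Type u := X.functionField
  let : Field K := inferInstanceAs (Field X.functionField)
  let : Algebra k K := φ.hom.toAlgebra
  let : Algebra k₀ K := (φ.hom.comp (algebraMap k₀ k)).toAlgebra
  have : IsScalarTower k₀ k K := .of_algebraMap_eq fun _ ↦ rfl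
  have hpts : (Points π K).Nonempty := by
    by_contra hne
    obtain ⟨W, hW, ⟨x, hx⟩, hempty⟩ := exists_isAffineOpen_forall_points_notMem hd
    have : IsAffine W := hW
    have hg : genericPoint X ∈ W :=
      ((genericPoint_spec X).specializes trivial).mem_open W.2 hx
    have hp : W.fromSpecStalkOfMem _ hg ∈ Points (W.ι ≫ s) K := by
      change _ = _
      rw [← Category.assoc, Scheme.Opens.fromSpecStalkOfMem_ι]
      exact hφ.symm
    obtain ⟨p, hp⟩ := h.2 _ _ (isQuasiProjective_of_isAffine (W.ι ≫ s))
      ⟨K, _, _, _, ‹_›, Set.not_nonempty_iff_eq_empty.mp hne, _, hp⟩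
    exact Set.eq_empty_iff_forall_notMem.mp hempty p hp
  obtain ⟨g, hg⟩ := (points_baseChange_nonempty_iff π k K).mpr hpts
  let f := Scheme.RationalMap.equivFunctionField s (BaseChange.toSpec π k) ⟨g, hg.trans hφ⟩
  refine ⟨f.1, f.2, fun hc ↦ ?_⟩
  exact ((points_baseChange_nonempty_iff π k k).mp hc.points_nonempty).ne_empty h.1

/-! ### The two conditions imply existential closedness. -/

/-- A subfield of a model is a model, so `k(a) ⊆ l` with `a` algebraic cannot be a proper extension.
-/
theorem ConditionI.isIntegrallyClosedIn {k₀ : Type u} [Field k₀] {V : Scheme.{u}}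
    {π : V ⟶ Spec (.of k₀)} {k : Type u} [Field k] [Algebra k₀ k] (h : ConditionI π k)
    (l : Type u) [Field l] [Algebra k₀ l] [Algebra k l] [IsScalarTower k₀ k l]
    (hl : IsModel π l) : IsIntegrallyClosedIn k l := by
  refine isIntegrallyClosedIn_iff.mpr ⟨(algebraMap k l).injective, fun {a} ha ↦ ?_⟩
  let E := IntermediateField.adjoin k {a}
  have : FiniteDimensional k E := IntermediateField.adjoin.finiteDimensional ha
  have hE : IsModel π E := hl.of_algHom (E.val.restrictScalars k₀)
  have hs : Function.Surjective (algebraMap k E) := by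
    by_contra hs
    exact (h E ‹_› hs).ne_empty hE
  obtain ⟨c, hc⟩ := hs ⟨a, IntermediateField.mem_adjoin_simple_self k a⟩
  exact ⟨c, congrArg Subtype.val hc⟩

-- By flatness `B ⊗ K` embeds in `l ⊗ K`, a domain because `l/k` is regular.
open TensorProduct in
theorem geometricallyIntegral_Spec {k l B : Type u} [Field k] [CharZero k] [Field l] [Algebra k l]
    [IsIntegrallyClosedIn k l] [CommRing B] [Algebra k B] (i : B →ₐ[k] l)
    (hi : Function.Injective i) :
    GeometricallyIntegral (Spec.map (CommRingCat.ofHom (algebraMap k B))) := by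
  refine ⟨geometrically_iff_of_commRing.mpr fun K _ _ Z fst snd h ↦ ?_⟩
  have : IsDomain (l ⊗[k] K) := isDomain_tensorProduct_of_isIntegrallyClosedIn
  have h_inj : Function.Injective (Algebra.TensorProduct.map i (AlgHom.id k K)) :=
    Module.Flat.rTensor_preserves_injective_linearMap _ hi
  have : IsDomain (B ⊗[k] K) :=
    h_inj.isDomain (Algebra.TensorProduct.map i (AlgHom.id k K)).toRingHom
  let e := h.isoPullback ≪≫ pullbackSpecIso k B K
  have : Nonempty Z := ⟨e.inv (Nonempty.some inferInstance)⟩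
  exact isIntegral_of_isOpenImmersion e.hom

/-- Injectivity of `i` sends `Spec l` to the generic point, where every rational map is defined. -/
theorem points_nonempty_of_rationalMap {k : Type u} [Field k] {R : CommRingCat.{u}} [IsDomain R]
    {α : .of k ⟶ R} {Y : Scheme.{u}} {sY : Y ⟶ Spec (.of k)} [LocallyOfFiniteType sY]
    {l : Type u} [Field l] [Algebra k l] (i : R →+* l) (hi : Function.Injective i)
    (hα : i.comp α.hom = algebraMap k l) {f : Spec R ⤏ Y}
    (hf : IsOverBase (Spec.map α) sY f) : (Points sY l).Nonempty := by
  obtain ⟨g, hg⟩ := (Scheme.RationalMap.equivFunctionField _ _).symm ⟨f, hf⟩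
  let j : (Spec R).functionField →+* l := IsFractionRing.lift hi
  have hτ : (Spec R).fromSpecStalk (genericPoint (Spec R)) =
      Spec.map (CommRingCat.ofHom (algebraMap R (Spec R).functionField)) :=
    Spec.fromSpecStalk_eq' R _
  have hj : α ≫ CommRingCat.ofHom (algebraMap R (Spec R).functionField) ≫ CommRingCat.ofHom j =
      CommRingCat.ofHom (algebraMap k l) := by
    ext a
    exact (IsFractionRing.lift_algebraMap hi (α.hom a)).trans congr($hα a)
  refine ⟨Spec.map (CommRingCat.ofHom j) ≫ g, ?_⟩
  change _ = _
  rw [Category.assoc, hg, hτ, ← hj, Spec.map_comp, Spec.map_comp, Category.assoc]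

theorem isExistentiallyClosed_of_conditions {k₀ : Type u} [Field k₀] [CharZero k₀]
    {V : Scheme.{u}} {π : V ⟶ Spec (.of k₀)} (hV : IsQuasiProjective π) {k : Type u} [Field k]
    [Algebra k₀ k] (hk : IsModel π k) (h₁ : ConditionI π k) (h₂ : ConditionII π k) :
    IsExistentiallyClosed π k := by
  refine ⟨hk, ?_⟩
  rintro X s hs ⟨l, _, _, _, _, hl, p, hp⟩
  have : CharZero k := charZero_of_injective_algebraMap (algebraMap k₀ k).injective
  have := hs.locallyOfFiniteType
  have := hV.locallyOfFiniteType
  have := h₁.isIntegrallyClosedIn l hl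
  obtain ⟨W, hW, hxW, -⟩ :=
    exists_isAffineOpen_mem_and_subset (U := ⊤) (x := p (IsLocalRing.closedPoint l)) trivial
  have : IsAffine W := hW
  have hrange : Set.range p ⊆ Set.range W.ι := by
    rintro _ ⟨y, rfl⟩
    rw [Subsingleton.elim (α := PrimeSpectrum l) y (IsLocalRing.closedPoint l)]
    simpa using hxW
  obtain ⟨φ, hφ⟩ := Spec.map_surjective (IsOpenImmersion.lift W.ι p hrange ≫ W.toScheme.isoSpec.hom)
  obtain ⟨α, hα⟩ := Spec.map_surjective (W.toScheme.isoSpec.inv ≫ W.ι ≫ s)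
  let A : Type u := Γ(W, ⊤)
  let : Algebra k A := α.hom.toAlgebra
  have : Algebra.FiniteType k A := by
    have : LocallyOfFiniteType (Spec.map α) := hα ▸ inferInstance
    exact HasRingHomProperty.Spec_iff.mp this
  have hcomm : α ≫ φ = CommRingCat.ofHom (algebraMap k l) := by
    apply Spec.map_injective
    rw [Spec.map_comp, hφ, hα]
    have hp' : p ≫ s = Spec.map (CommRingCat.ofHom (algebraMap k l)) := hp
    simpa using hp'
  let ψ : A →ₐ[k] l := { φ.hom with commutes' := fun a ↦ congr($hcomm a) }
  -- Replacing `A` by its image in `l` makes the `l`-point generic.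
  let B := ψ.range
  have : Algebra.FiniteType k B := .of_surjective ψ.rangeRestrict ψ.rangeRestrict_surjective
  let sB := Spec.map (CommRingCat.ofHom (algebraMap k B))
  have hB : IsVariety sB :=
    ⟨inferInstance, HasRingHomProperty.Spec_iff.mpr
      (RingHom.finiteType_algebraMap.mpr ‹Algebra.FiniteType k B›), inferInstance⟩
  have hsB : sB = (Spec.map (CommRingCat.ofHom ψ.rangeRestrict.toRingHom) ≫
      W.toScheme.isoSpec.inv ≫ W.ι) ≫ s := by
    have hβ : CommRingCat.ofHom (algebraMap k B) =
        α ≫ CommRingCat.ofHom ψ.rangeRestrict.toRingHom := by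
      ext a
      exact congrArg Subtype.val (ψ.rangeRestrict.commutes a).symm
    rw [Category.assoc, Category.assoc, ← hα, ← Spec.map_comp]
    exact congrArg Spec.map hβ
  rcases h₂ _ sB hB (geometricallyIntegral_Spec B.val Subtype.val_injective) with
    ⟨f, hf, -⟩ | hd
  · have := points_nonempty_of_rationalMap (R := .of B) (l := l) B.val.toRingHom
      Subtype.val_injective B.val.comp_algebraMap hf
    exact absurd hl ((points_baseChange_nonempty_iff π k l).mp this).ne_empty
  · obtain ⟨-, q, hq, -⟩ := Dense.nonempty hd
    exact ⟨_, Points.comp_hom _ (hsB ▸ hq)⟩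

end AvoidingFields

theorem mainTheorem7 {k₀ : Type u} [Field k₀] [CharZero k₀] {V : Scheme.{u}}
    (π : V ⟶ Spec (.of k₀)) (hV : AvoidingFields.IsQuasiProjective π)
    (k : Type u) [Field k] [Algebra k₀ k] (hk : AvoidingFields.IsModel π k) :
    AvoidingFields.IsExistentiallyClosed π k ↔
      AvoidingFields.ConditionI π k ∧ AvoidingFields.ConditionII π k :=
  ⟨fun h ↦ ⟨h.conditionI, h.conditionII hV⟩,
    fun h ↦ AvoidingFields.isExistentiallyClosed_of_conditions hV hk h.1 h.2⟩
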